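/- Let $x_0=(x_k(0))_{k\in\mathbb Z}\in\ell^\infty(\mathbb Z)$ be a bounded sequence of complex numbers (an initial constellation) and consider the system $$\dot x_k(t)=\tfrac12\big(x_{k-1}(t)+x_{k+1}(t)\big)-x_k(t),\qquad k\in\mathbb Z,\ t\ge 0,$$ with initial value $x_0$. By a solution we mean a family of functions $x_k:[0,\infty)\to\mathbb C$ which satisfies these equations, has the prescribed initial values, and for which $x(t)=(x_k(t))_{k\in\mathbb Z}$ is bounded in $\ell^\infty(\mathbb Z)$ on bounded time intervals. There is exactly one solution. The constellation $x_0$ is called good if there exist $c_k\in\mathbb C$, $k\in\mathbb Z$, such that the solution satisfies $\sup_{k\in\mathbb Z}|x_k(t)-c_k|\to0$ as $t\to\infty$. The constellation $x_0$ is good if and only if there exists $c\in\mathbb C$ such that $$\sup_{k\in\mathbb Z}\bigg|\frac1n\sum_{j=1}^n\frac1{2^j}\sum_{\ell=0}^j\binom j\ell x_{k-j+2\ell}(0)-c\bigg|\to0,\qquad n\to\infty,\tag{1}$$ and if this is the case then, with the same $c$, $$\sup_{k\in\mathbb Z}|x_k(t)-c|\to0,\qquad t\to\infty.\tag{2}$$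 Furthermore, if the left-hand side of (1) is $O(n^{-1})$ as $n\to\infty$ for some $c\in\mathbb C$, then, with the same $c$, the left-hand side of (2) is $O(t^{-1})$ as $t\to\infty$. -/

import Mathlib

open Filter Topology
open scoped ENNReal

/-- The supremum distance `sup_k |u_k - v_k|` of two doubly infinite sequences, as an extended
nonnegative number (it is `∞` when `u - v` is unbounded). -/
noncomputable def supDist (u v : ℤ → ℂ) : ℝ≥0∞ :=
  ⨆ k : ℤ, ‖u k - v k‖ₑ

/-- `x` solves `x_k' = (x_{k-1} + x_{k+1}) / 2 - x_k` for all `k ∈ ℤ`, `t ≥ 0`, with initial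
constellation `x₀`, as a motion in `ℓ^∞(ℤ)`: the supremum norm of `x t` is bounded on bounded time
intervals. (Without such a condition the infinite system has many solutions with the same initial
values.) The derivative at `t = 0` is one-sided, and values at negative times play no role. -/
structure IsSymmetricSolution (x₀ : ℤ → ℂ) (x : ℝ → ℤ → ℂ) : Prop where
  initial : x 0 = x₀
  locally_bounded : ∀ T : ℝ, ∃ M : ℝ, ∀ t ∈ Set.Icc 0 T, ∀ k : ℤ, ‖x t k‖ ≤ M
  ode : ∀ k : ℤ, ∀ t : ℝ, 0 ≤ t →
    HasDerivWithinAt (fun s => x s k) ((1 / 2) * (x t (k - 1) + x t (k + 1)) - x t k)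
      (Set.Ici 0) t

/-- The initial constellation `x₀` is good: the solution converges, uniformly in `k`, to some
sequence `(c_k)`. -/
def IsGood (x₀ : ℤ → ℂ) : Prop :=
  ∃ x : ℝ → ℤ → ℂ, IsSymmetricSolution x₀ x ∧
    ∃ c : ℤ → ℂ, Tendsto (fun t : ℝ => supDist (x t) c) atTop (𝓝 0)

/-- The binomial average `2^{-j} ∑_{ℓ=0}^j (j choose ℓ) x_{k-j+2ℓ}`. -/
noncomputable def binomialAverage (x₀ : ℤ → ℂ) (j : ℕ) (k : ℤ) : ℂ :=
  (1 / 2 ^ j) * ∑ l ∈ Finset.range (j + 1), (j.choose l : ℂ) * x₀ (k - (j : ℤ) + 2 * (l : ℤ))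

/-- The Cesàro mean `(1/n) ∑_{j=1}^n` of the binomial averages. -/
noncomputable def cesaroMean (x₀ : ℤ → ℂ) (n : ℕ) (k : ℤ) : ℂ :=
  (1 / (n : ℂ)) * ∑ j ∈ Finset.Icc 1 n, binomialAverage x₀ j k

/-! On `ℓ^∞(ℤ)` the solution is `T_t x₀` with `T_t = e^{t(P-1)}`, where `P = (S + S⁻¹)/2` for the
unit shift `S`; the sums in (1) are the means `A_n` of the powers of `P`, by the binomial theorem.
The analytic core is `‖T_t (P-1)‖ ≤ 1/t`. Since `P - 1 = -(S-1)(S⁻¹-1)/2` and `T_t` splits into the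
commuting factors `e^{(t/2)(S-1)}` and `e^{(t/2)(S⁻¹-1)}`, it reduces to `‖(U-1)e^{s(U-1)}‖ ≤ 1/√s`
for a contraction `U`, which is a Poisson variance bound (`norm_sub_one_mul_exp_le`). Then `A_n(T_t
- 1) → 0` as `n → ∞` for fixed `t`, and `T_t(1 - A_n) → 0` as `t → ∞` for fixed `n`, so `T_t y → 0`
iff `A_n y → 0`. Limits of `T_t x₀` are bounded harmonic sequences, hence constant; subtracting the
constant reduces everything to limit `0`. The rate is `norm_expSemigroup_apply_le_of_norm_sum_le`.
-/

open scoped BoundedContinuousFunction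

/-! ### Poisson moments. -/

/-- The weight `e^{-s} s^n / n!` of the Poisson distribution. -/
noncomputable def poissonWeight (s : ℝ) (n : ℕ) : ℝ :=
  Real.exp (-s) * (s ^ n / n.factorial)

lemma poissonWeight_nonneg {s : ℝ} (hs : 0 ≤ s) (n : ℕ) : 0 ≤ poissonWeight s n := by
  unfold poissonWeight; positivity

lemma poissonWeight_succ (s : ℝ) (n : ℕ) :
    ((n + 1 : ℕ) : ℝ) * poissonWeight s (n + 1) = s * poissonWeight s n := by
  unfold poissonWeight
  rw [Nat.factorial_succ]
  push_cast
  have h1 : (n.factorial : ℝ) ≠ 0 := by exact_mod_cast n.factorial_ne_zero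
  have h2 : (n : ℝ) + 1 ≠ 0 := by positivity
  field_simp
  ring

lemma hasSum_poissonWeight (s : ℝ) : HasSum (poissonWeight s) 1 := by
  have h := (NormedSpace.expSeries_div_hasSum_exp s).mul_left (Real.exp (-s))
  rwa [← Real.exp_eq_exp_ℝ, ← Real.exp_add, neg_add_cancel, Real.exp_zero] at h

/-- The factor `n` is absorbed by an index shift. This yields both the scalar moments and the
operator series with weights `n`. -/
lemma hasSum_nat_mul_poissonWeight_smul {E : Type*} [NormedAddCommGroup E] [NormedSpace ℝ E]
    {s : ℝ} {g : ℕ → E} {a : E} (h : HasSum (fun n => poissonWeight s n • g (n + 1)) a) :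
    HasSum (fun n : ℕ => ((n : ℝ) * poissonWeight s n) • g n) (s • a) := by
  rw [← hasSum_nat_add_iff' 1]
  simp only [poissonWeight_succ, Finset.sum_range_one, Nat.cast_zero, zero_mul, zero_smul, sub_zero]
  simpa only [mul_smul] using h.const_smul s

lemma hasSum_poissonWeight_mul_sq {s : ℝ} (hs : s ≠ 0) :
    HasSum (fun n : ℕ => poissonWeight s n * ((n : ℝ) / s - 1) ^ 2) (1 / s) := by
  have h0 := hasSum_poissonWeight s
  have h1 : HasSum (fun n : ℕ => ((n : ℝ) * poissonWeight s n)) s := by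
    have h := hasSum_nat_mul_poissonWeight_smul (s := s) (g := fun _ => (1 : ℝ)) (by simpa using h0)
    simpa only [smul_eq_mul, mul_one] using h
  have h2 : HasSum (fun n : ℕ => ((n : ℝ) * poissonWeight s n) * (n : ℝ)) (s * (s + 1)) := by
    refine hasSum_nat_mul_poissonWeight_smul (s := s) (g := fun n => (n : ℝ)) ?_
    refine (h1.add h0).congr_fun fun n => ?_
    push_cast; rw [smul_eq_mul]; ring
  have e : 1 / s = 1 / s ^ 2 * (s * (s + 1)) - 2 / s * s + 1 := by field_simp; ring
  rw [e]
  refine (((h2.mul_left (1 / s ^ 2)).sub (h1.mul_left (2 / s))).add h0).congr_fun fun n => ?_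
  field_simp; ring

lemma norm_pow_le_one_of_norm_le_one {𝔸 : Type*} [NormedRing 𝔸] [NormOneClass 𝔸] {U : 𝔸}
    (hU : ‖U‖ ≤ 1) (n : ℕ) : ‖U ^ n‖ ≤ 1 :=
  (norm_pow_le U n).trans (pow_le_one₀ (norm_nonneg _) hU)

/-! ### Exponentials of a contraction as Poisson averages of its powers. -/

section Algebra

variable {𝔸 : Type*} [NormedRing 𝔸] [NormedAlgebra ℝ 𝔸] [CompleteSpace 𝔸]

lemma hasSum_poissonWeight_smul_pow (U : 𝔸) (s : ℝ) :
    HasSum (fun n => poissonWeight s n • U ^ n) (NormedSpace.exp (s • (U - 1))) := by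
  have h := (NormedSpace.exp_series_hasSum_exp' (𝕂 := ℝ) (s • U)).const_smul (Real.exp (-s))
  have e : NormedSpace.exp (s • (U - 1)) = Real.exp (-s) • NormedSpace.exp (s • U) := by
    have hc : Commute (algebraMap ℝ 𝔸 (-s)) (s • U) := Algebra.commutes _ _
    have h1 : s • (U - 1) = algebraMap ℝ 𝔸 (-s) + s • U := by
      rw [Algebra.algebraMap_eq_smul_one]; module
    have : NormedAlgebra ℚ 𝔸 := NormedAlgebra.restrictScalars ℚ ℝ 𝔸
    rw [h1, NormedSpace.exp_add_of_commute hc, ← NormedSpace.algebraMap_exp_comm,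
      ← Real.exp_eq_exp_ℝ, ← Algebra.smul_def]
  rw [e]
  refine h.congr_fun fun n => ?_
  rw [smul_pow, smul_smul, smul_smul, poissonWeight]
  congr 1; ring

variable [NormOneClass 𝔸]

lemma norm_exp_smul_sub_one_le {U : 𝔸} (hU : ‖U‖ ≤ 1) {s : ℝ} (hs : 0 ≤ s) :
    ‖NormedSpace.exp (s • (U - 1))‖ ≤ 1 := by
  rw [← (hasSum_poissonWeight_smul_pow U s).tsum_eq]
  refine tsum_of_norm_bounded (hasSum_poissonWeight s) fun n => ?_
  rw [norm_smul, Real.norm_of_nonneg (poissonWeight_nonneg hs n)]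
  exact mul_le_of_le_one_right (poissonWeight_nonneg hs n) (norm_pow_le_one_of_norm_le_one hU n)

/-- The operator is the Poisson average of `(n/s - 1) U^n`, so its norm is at most the mean of `|n/s
- 1|`, which the variance `1/s` controls. -/
lemma norm_sub_one_mul_exp_le {U : 𝔸} (hU : ‖U‖ ≤ 1) {s : ℝ} (hs : 0 < s) :
    ‖(U - 1) * NormedSpace.exp (s • (U - 1))‖ ≤ 1 / √s := by
  have h0 := hasSum_poissonWeight_smul_pow U s
  have h1 : HasSum (fun n : ℕ => ((n : ℝ) * poissonWeight s n) • U ^ n)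
      (s • (U * NormedSpace.exp (s • (U - 1)))) := by
    refine hasSum_nat_mul_poissonWeight_smul ((h0.mul_left U).congr_fun fun n => ?_)
    rw [mul_smul_comm, pow_succ']
  have h2 : HasSum (fun n : ℕ => (poissonWeight s n * ((n : ℝ) / s - 1)) • U ^ n)
      ((U - 1) * NormedSpace.exp (s • (U - 1))) := by
    have h := (h1.const_smul s⁻¹).sub h0
    rw [smul_smul, inv_mul_cancel₀ hs.ne', one_smul, ← sub_one_mul] at h
    refine h.congr_fun fun n => ?_
    rw [smul_smul, ← sub_smul]
    congr 1; field_simp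
  have hr : 0 < √s := Real.sqrt_pos.2 hs
  -- AM-GM replaces Cauchy-Schwarz: `a ≤ (√s/2) a² + 1/(2√s)`, weighted so that both terms average
  -- to `1/(2√s)`.
  have h3 : HasSum (fun n : ℕ => poissonWeight s n *
      (√s / 2 * ((n : ℝ) / s - 1) ^ 2 + 1 / (2 * √s))) (1 / √s) := by
    have e : 1 / √s = √s / 2 * (1 / s) + 1 * (1 / (2 * √s)) := by
      have : √s / s = 1 / √s := Real.sqrt_div_self'
      linear_combination (-1 / 2) * this
    rw [e]
    refine (((hasSum_poissonWeight_mul_sq hs.ne').mul_left (√s / 2)).add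
      ((hasSum_poissonWeight s).mul_right (1 / (2 * √s)))).congr_fun fun n => ?_
    ring
  rw [← h2.tsum_eq]
  refine tsum_of_norm_bounded h3 fun n => ?_
  have hp := poissonWeight_nonneg hs.le n
  rw [norm_smul, norm_mul, Real.norm_of_nonneg hp, Real.norm_eq_abs]
  refine (mul_le_of_le_one_right (by positivity) (norm_pow_le_one_of_norm_le_one hU n)).trans ?_
  refine mul_le_mul_of_nonneg_left ?_ hp
  rw [← sq_abs]
  generalize |(n : ℝ) / s - 1| = a
  have : √s / 2 * a ^ 2 + 1 / (2 * √s) - a = (√s * a - 1) ^ 2 / (2 * √s) := by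
    field_simp; ring
  have : 0 ≤ (√s * a - 1) ^ 2 / (2 * √s) := by positivity
  linarith

end Algebra

/-! ### Power means and semigroup of a contraction. -/

section Contraction

variable {𝔸 : Type*} [NormedRing 𝔸]

lemma sum_Icc_pow_mul_sub_one (P : 𝔸) (n : ℕ) :
    (∑ j ∈ Finset.Icc 1 n, P ^ j) * (P - 1) = P ^ (n + 1) - P := by
  induction n with
  | zero => simp
  | succ n ih =>
    rw [Finset.sum_Icc_succ_top (by omega), add_mul, ih, mul_sub, mul_one, ← pow_succ]
    abel

variable [NormedAlgebra ℝ 𝔸]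

/-- The Cesàro mean `(1/n) ∑_{j=1}^n P^j` of the powers of `P`. -/
noncomputable def powerMean (P : 𝔸) (n : ℕ) : 𝔸 := (n : ℝ)⁻¹ • ∑ j ∈ Finset.Icc 1 n, P ^ j

/-- The semigroup `e^{t(P - 1)}`. -/
noncomputable def expSemigroup (P : 𝔸) (t : ℝ) : 𝔸 := NormedSpace.exp (t • (P - 1))

lemma powerMean_mul_sub_one (P : 𝔸) (n : ℕ) :
    powerMean P n * (P - 1) = (n : ℝ)⁻¹ • (P ^ (n + 1) - P) := by
  rw [powerMean, smul_mul_assoc, sum_Icc_pow_mul_sub_one]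

lemma commute_expSemigroup (P : 𝔸) (t : ℝ) : Commute P (expSemigroup P t) :=
  (((Commute.refl P).sub_right (Commute.one_right P)).smul_right t).exp_right

lemma commute_sub_one_expSemigroup (P : 𝔸) (t : ℝ) : Commute (P - 1) (expSemigroup P t) :=
  (commute_expSemigroup P t).sub_left (Commute.one_left _)

lemma expSemigroup_zero (P : 𝔸) : expSemigroup P 0 = 1 := by
  rw [expSemigroup, zero_smul, NormedSpace.exp_zero]

lemma one_sub_powerMean (P : 𝔸) {n : ℕ} (hn : n ≠ 0) :
    1 - powerMean P n = (n : ℝ)⁻¹ • ∑ j ∈ Finset.Icc 1 n, (1 - P ^ j) := by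
  rw [Finset.sum_sub_distrib, smul_sub, powerMean]
  congr 1
  rw [Finset.sum_const,
    Nat.card_Icc, Nat.add_sub_cancel, ← Nat.cast_smul_eq_nsmul ℝ, smul_smul,
    inv_mul_cancel₀ (by exact_mod_cast hn), one_smul]

lemma inv_natCast_mul_le_of_ne_zero {n : ℕ} (hn : n ≠ 0) {a b : ℝ} (h : a ≤ n * b) :
    (n : ℝ)⁻¹ * a ≤ b := by
  rw [inv_mul_le_iff₀ (by exact_mod_cast Nat.pos_of_ne_zero hn)]
  exact h

variable [NormOneClass 𝔸] {P : 𝔸} (hP : ‖P‖ ≤ 1)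
include hP

omit [NormedAlgebra ℝ 𝔸] in
lemma norm_sum_Icc_pow_le (n : ℕ) : ‖∑ j ∈ Finset.Icc 1 n, P ^ j‖ ≤ n :=
  (norm_sum_le_of_le _ fun j _ => norm_pow_le_one_of_norm_le_one hP j).trans (by simp)

lemma norm_powerMean_le (n : ℕ) : ‖powerMean P n‖ ≤ 1 := by
  rcases eq_or_ne n 0 with rfl | hn
  · simp [powerMean]
  rw [powerMean, norm_smul, norm_inv, Real.norm_natCast]
  exact inv_natCast_mul_le_of_ne_zero hn (by simpa using norm_sum_Icc_pow_le hP n)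

lemma norm_powerMean_mul_sub_one_le (n : ℕ) : ‖powerMean P n * (P - 1)‖ ≤ 2 * (n : ℝ)⁻¹ := by
  rw [powerMean_mul_sub_one, norm_smul, norm_inv, Real.norm_natCast, mul_comm]
  gcongr
  exact (norm_sub_le _ _).trans (by linarith [norm_pow_le_one_of_norm_le_one hP (n + 1)])

omit [NormedAlgebra ℝ 𝔸] in
lemma norm_mul_one_sub_pow_le (Q : 𝔸) (j : ℕ) : ‖Q * (1 - P ^ j)‖ ≤ j * ‖Q * (P - 1)‖ := by
  have h : Q * (1 - P ^ j) = -(Q * (P - 1) * ∑ i ∈ Finset.range j, P ^ i) := by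
    rw [mul_assoc, mul_geom_sum, ← mul_neg, neg_sub]
  rw [h, norm_neg, mul_comm]
  refine (norm_mul_le _ _).trans ?_
  gcongr
  exact (norm_sum_le_of_le _ fun i _ => norm_pow_le_one_of_norm_le_one hP i).trans (by simp)

lemma norm_mul_one_sub_powerMean_le (Q : 𝔸) {n : ℕ} (hn : n ≠ 0) :
    ‖Q * (1 - powerMean P n)‖ ≤ n * ‖Q * (P - 1)‖ := by
  rw [one_sub_powerMean P hn, mul_smul_comm, norm_smul, norm_inv, Real.norm_natCast,
    Finset.mul_sum]
  refine inv_natCast_mul_le_of_ne_zero hn ?_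
  refine (norm_sum_le_of_le (f := fun j => Q * (1 - P ^ j)) (n := fun _ => n * ‖Q * (P - 1)‖) _
    fun j hj => ?_).trans (by simp)
  refine (norm_mul_one_sub_pow_le hP Q j).trans ?_
  gcongr
  exact (Finset.mem_Icc.1 hj).2

variable [CompleteSpace 𝔸]

lemma norm_expSemigroup_le {t : ℝ} (ht : 0 ≤ t) : ‖expSemigroup P t‖ ≤ 1 :=
  norm_exp_smul_sub_one_le hP ht

/-- Mean value inequality: the derivative `A_n (P-1) T_u` has norm at most `2/n`, because `A_n
(P-1)` telescopes. -/
lemma norm_powerMean_mul_expSemigroup_sub_one_le (n : ℕ) {t : ℝ} (ht : 0 ≤ t) :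
    ‖powerMean P n * (expSemigroup P t - 1)‖ ≤ 2 * (n : ℝ)⁻¹ * t := by
  have h := norm_image_sub_le_of_norm_deriv_le_segment' (a := 0) (b := t)
    (f := fun u => powerMean P n * expSemigroup P u)
    (f' := fun u => powerMean P n * ((P - 1) * expSemigroup P u)) (C := 2 * (n : ℝ)⁻¹)
    (fun u _ => ((hasDerivAt_exp_smul_const' (P - 1) u).const_mul _).hasDerivWithinAt)
    (fun u hu => ?_) t ⟨ht, le_rfl⟩
  · rwa [expSemigroup_zero, ← mul_sub, sub_zero] at h
  · rw [← mul_assoc]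
    refine (norm_mul_le _ _).trans ?_
    exact (mul_le_of_le_one_right (norm_nonneg _) (norm_expSemigroup_le hP hu.1)).trans
      (norm_powerMean_mul_sub_one_le hP n)

end Contraction

/-! ### The `1/t` bound for the symmetric generator. -/

section InverseContractions

lemma half_smul_add_pow {𝔸 : Type*} [Ring 𝔸] [Algebra ℝ 𝔸] {S R : 𝔸} (h : Commute S R) (j : ℕ) :
    ((1 / 2 : ℝ) • (S + R)) ^ j = (1 / 2 : ℝ) ^ j •
      ∑ l ∈ Finset.range (j + 1), (j.choose l : ℝ) • (S ^ l * R ^ (j - l)) := by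
  rw [smul_pow, h.add_pow]
  congr 1
  refine Finset.sum_congr rfl fun l _ => ?_
  rw [← nsmul_eq_mul', Nat.cast_smul_eq_nsmul]

variable {𝔸 : Type*} [NormedRing 𝔸] [NormedAlgebra ℝ 𝔸] [CompleteSpace 𝔸] [NormOneClass 𝔸]

/-- The semigroup generated by `(S + S⁻¹) / 2 - 1`, for mutually inverse contractions `S`, `S⁻¹`,
is bounded analytic. -/
lemma norm_expSemigroup_mul_sub_one_le {S R : 𝔸} (hS : ‖S‖ ≤ 1) (hR : ‖R‖ ≤ 1)
    (hSR : S * R = 1) (hRS : R * S = 1) {t : ℝ} (ht : 0 < t) :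
    ‖expSemigroup ((1 / 2 : ℝ) • (S + R)) t * ((1 / 2 : ℝ) • (S + R) - 1)‖ ≤ t⁻¹ := by
  have hc : Commute (S - 1) (R - 1) := by
    have : Commute S R := hSR.trans hRS.symm
    exact (this.sub_right (Commute.one_right _)).sub_left (Commute.one_left _)
  have h1 : (1 / 2 : ℝ) • (S + R) - 1 = (-1 / 2 : ℝ) • ((S - 1) * (R - 1)) := by
    rw [sub_mul, mul_sub, hSR]; simp only [mul_one, one_mul]; module
  have h2 : t • ((1 / 2 : ℝ) • (S + R) - 1) = (t / 2) • (S - 1) + (t / 2) • (R - 1) := by module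
  have : NormedAlgebra ℚ 𝔸 := NormedAlgebra.restrictScalars ℚ ℝ 𝔸
  have h3 : expSemigroup ((1 / 2 : ℝ) • (S + R)) t =
      NormedSpace.exp ((t / 2) • (S - 1)) * NormedSpace.exp ((t / 2) • (R - 1)) := by
    rw [expSemigroup, h2, NormedSpace.exp_add_of_commute ((hc.smul_left _).smul_right _)]
  have hc' : Commute (R - 1) (NormedSpace.exp ((t / 2) • (S - 1))) :=
    (hc.symm.smul_right _).exp_right
  rw [← (commute_sub_one_expSemigroup _ t).eq, h3]
  have h4 : ((1 / 2 : ℝ) • (S + R) - 1) *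
      (NormedSpace.exp ((t / 2) • (S - 1)) * NormedSpace.exp ((t / 2) • (R - 1))) =
      (-1 / 2 : ℝ) • (((S - 1) * NormedSpace.exp ((t / 2) • (S - 1))) *
        ((R - 1) * NormedSpace.exp ((t / 2) • (R - 1)))) := by
    rw [h1, smul_mul_assoc, mul_assoc, ← mul_assoc (R - 1), hc'.eq]
    simp only [mul_assoc]
  have ht2 : 0 < t / 2 := by positivity
  rw [h4, norm_smul]
  -- Each one-sided semigroup runs for time `t/2` and contributes `√(2/t)`.
  calc ‖(-1 / 2 : ℝ)‖ * _ ≤ (1 / 2) * (1 / √(t / 2) * (1 / √(t / 2))) := by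
        refine mul_le_mul (by norm_num) ((norm_mul_le _ _).trans ?_) (norm_nonneg _) (by norm_num)
        exact mul_le_mul (norm_sub_one_mul_exp_le hS ht2) (norm_sub_one_mul_exp_le hR ht2)
          (norm_nonneg _) (by positivity)
    _ = t⁻¹ := by
        rw [div_mul_div_comm, Real.mul_self_sqrt ht2.le]; field_simp

end InverseContractions

/-! ### Comparing the semigroup with the power means. -/

section MeanErgodic

variable {E : Type*} [NormedAddCommGroup E] [NormedSpace ℝ E] [CompleteSpace E] [Nontrivial E]
  {P : E →L[ℝ] E} (hP : ‖P‖ ≤ 1)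
include hP

lemma norm_expSemigroup_apply_le {t : ℝ} (ht : 0 ≤ t) (y : E) : ‖expSemigroup P t y‖ ≤ ‖y‖ := by
  simpa using ContinuousLinearMap.le_of_opNorm_le _ (norm_expSemigroup_le hP ht) y

omit [CompleteSpace E] [Nontrivial E] hP in
/-- A limit of the semigroup is a fixed point of `P`. -/
lemma apply_eq_of_tendsto_expSemigroup
    (hA : Tendsto (fun t => ‖expSemigroup P t * (P - 1)‖) atTop (𝓝 0)) {y z : E}
    (h : Tendsto (fun t => expSemigroup P t y) atTop (𝓝 z)) : P z = z := by
  have h1 : Tendsto (fun t => (P - 1) (expSemigroup P t y)) atTop (𝓝 ((P - 1) z)) :=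
    ((P - 1).continuous.tendsto z).comp h
  have h2 : Tendsto (fun t => (P - 1) (expSemigroup P t y)) atTop (𝓝 0) := by
    refine squeeze_zero_norm (a := fun t => ‖expSemigroup P t * (P - 1)‖ * ‖y‖) (fun t => ?_) ?_
    · rw [← mul_apply_eq_comp, (commute_sub_one_expSemigroup _ t).eq]
      exact ContinuousLinearMap.le_opNorm _ _
    · simpa using hA.mul_const ‖y‖
  exact sub_eq_zero.1 (tendsto_nhds_unique h1 h2)

/-- Fix one `t` with `T_t y` small; replacing `y` by `T_t y` inside `A_n` costs `O(t/n)`. -/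
lemma tendsto_powerMean_of_tendsto_expSemigroup {y : E}
    (h : Tendsto (fun t => expSemigroup P t y) atTop (𝓝 0)) :
    Tendsto (fun n => powerMean P n y) atTop (𝓝 0) := by
  rw [Metric.tendsto_atTop] at h ⊢
  intro ε hε
  obtain ⟨T, hT⟩ := h (ε / 2) (half_pos hε)
  set t := max T 0
  have h1 : Tendsto (fun n : ℕ => 2 * (n : ℝ)⁻¹ * t * ‖y‖) atTop (𝓝 0) := by
    have := (((tendsto_inv_atTop_nhds_zero_nat (𝕜 := ℝ)).const_mul 2).mul_const t).mul_const ‖y‖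
    simpa using this
  obtain ⟨N, hN⟩ := eventually_atTop.1 (h1.eventually_lt_const (half_pos hε))
  refine ⟨N, fun n hn => ?_⟩
  have h2 := hT t (le_max_left _ _)
  rw [dist_zero_right] at h2 ⊢
  have e : powerMean P n y = powerMean P n (expSemigroup P t y) -
      (powerMean P n * (expSemigroup P t - 1)) y := by
    simp [map_sub]
  rw [e]
  calc _ ≤ ‖powerMean P n (expSemigroup P t y)‖ +
        ‖(powerMean P n * (expSemigroup P t - 1)) y‖ := norm_sub_le _ _
    _ ≤ 1 * ‖expSemigroup P t y‖ + 2 * (n : ℝ)⁻¹ * t * ‖y‖ := by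
        gcongr
        · exact ContinuousLinearMap.le_of_opNorm_le _ (norm_powerMean_le hP n) _
        · exact ContinuousLinearMap.le_of_opNorm_le _
            (norm_powerMean_mul_expSemigroup_sub_one_le hP n (le_max_right _ _)) _
    _ < ε := by linarith [hN n hn]

lemma tendsto_expSemigroup_of_tendsto_powerMean
    (hA : Tendsto (fun t => ‖expSemigroup P t * (P - 1)‖) atTop (𝓝 0)) {y : E}
    (h : Tendsto (fun n => powerMean P n y) atTop (𝓝 0)) :
    Tendsto (fun t => expSemigroup P t y) atTop (𝓝 0) := by
  rw [Metric.tendsto_atTop] at h ⊢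
  intro ε hε
  obtain ⟨N, hN⟩ := h (ε / 2) (half_pos hε)
  -- The index must be nonzero: the mean with `n = 0` is `0`, and `1 - A_0` is not controlled by `P
  -- - 1`.
  set n := N + 1
  have h1 : Tendsto (fun t : ℝ => n * ‖expSemigroup P t * (P - 1)‖ * ‖y‖) atTop (𝓝 0) := by
    simpa using (hA.const_mul (n : ℝ)).mul_const ‖y‖
  obtain ⟨T, hT⟩ := eventually_atTop.1 (h1.eventually_lt_const (half_pos hε))
  refine ⟨max T 0, fun t ht => ?_⟩
  have h2 := hN n (Nat.le_succ N)
  rw [dist_zero_right] at h2 ⊢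
  have e : expSemigroup P t y = expSemigroup P t (powerMean P n y) +
      (expSemigroup P t * (1 - powerMean P n)) y := by
    simp [map_sub]
  rw [e]
  calc _ ≤ ‖expSemigroup P t (powerMean P n y)‖ +
        ‖(expSemigroup P t * (1 - powerMean P n)) y‖ := norm_add_le _ _
    _ ≤ 1 * ‖powerMean P n y‖ + n * ‖expSemigroup P t * (P - 1)‖ * ‖y‖ := by
        gcongr
        · exact ContinuousLinearMap.le_of_opNorm_le _
            (norm_expSemigroup_le hP ((le_max_right _ _).trans ht)) _
        · exact ContinuousLinearMap.le_of_opNorm_le _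
            (norm_mul_one_sub_powerMean_le hP _ (Nat.succ_ne_zero N)) _
    _ < ε := by linarith [hT t ((le_max_left _ _).trans ht)]

omit [CompleteSpace E] in
-- For large `n` the rate cancels the factor `1/n`; the finitely many other sums are bounded
-- trivially.
lemma exists_bound_sum_of_norm_powerMean_le {y : E} {C : ℝ}
    (h : ∀ᶠ n : ℕ in atTop, ‖powerMean P n y‖ ≤ C * (n : ℝ)⁻¹) :
    ∃ D, 0 ≤ D ∧ ∀ n : ℕ, ‖(∑ j ∈ Finset.Icc 1 n, P ^ j) y‖ ≤ D := by
  obtain ⟨N, hN⟩ := eventually_atTop.1 h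
  refine ⟨|C| + N * ‖y‖, by positivity, fun n => ?_⟩
  rcases le_total n N with hn | hn
  · have := ContinuousLinearMap.le_of_opNorm_le _ (norm_sum_Icc_pow_le hP n) y
    have h2 : (n : ℝ) * ‖y‖ ≤ N * ‖y‖ := by gcongr
    linarith [abs_nonneg C]
  · rcases eq_or_ne n 0 with rfl | h0
    · simp; positivity
    have h1 := hN n hn
    have hpos : (0 : ℝ) < n := by exact_mod_cast Nat.pos_of_ne_zero h0
    rw [powerMean, smul_apply, norm_smul, norm_inv, Real.norm_natCast,
      mul_comm C, mul_le_mul_iff_right₀ (by positivity)] at h1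
    have : 0 ≤ (N : ℝ) * ‖y‖ := by positivity
    linarith [le_abs_self C]

omit [CompleteSpace E] [Nontrivial E] hP in
lemma sub_one_sum_sum_pow_apply (y : E) (N : ℕ) :
    (P - 1) (∑ n ∈ Finset.Icc 1 N, (∑ j ∈ Finset.Icc 1 n, P ^ j) y) =
      P ((∑ j ∈ Finset.Icc 1 N, P ^ j) y) - (N : ℝ) • P y := by
  have key : ∀ n : ℕ, (P - 1) ((∑ j ∈ Finset.Icc 1 n, P ^ j) y) = (P ^ (n + 1)) y - P y := by
    intro n
    have hc : Commute (P - 1) (∑ j ∈ Finset.Icc 1 n, P ^ j) :=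
      Commute.sum_right _ _ _ fun j _ =>
        ((Commute.refl P).sub_left (Commute.one_left P)).pow_right j
    rw [← mul_apply_eq_comp, hc.eq, sum_Icc_pow_mul_sub_one]
    rfl
  induction N with
  | zero => simp
  | succ N ih =>
    rw [Finset.sum_Icc_succ_top (by omega), map_add, ih, key,
      Finset.sum_Icc_succ_top (by omega) (fun j => P ^ j), add_apply, map_add,
      ← mul_apply_eq_comp P (P ^ (N + 1)), ← pow_succ']
    push_cast
    module

/-- Averaging the bounded sums shows that `P y` is a limit of elements `(P-1)v` with `‖v‖ ≤ D`, so
`T_t P y` inherits the decay of `T_t (P-1)`. The term `‖y‖` pays for passing from `P y` to `y`. -/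
lemma norm_expSemigroup_apply_le_of_norm_sum_le {y : E} {D t : ℝ} (ht : 0 ≤ t)
    (hD : ∀ n : ℕ, ‖(∑ j ∈ Finset.Icc 1 n, P ^ j) y‖ ≤ D) :
    ‖expSemigroup P t y‖ ≤ ‖expSemigroup P t * (P - 1)‖ * (D + ‖y‖) := by
  set Q := expSemigroup P t with hQ
  have hQ1 : ‖Q‖ ≤ 1 := norm_expSemigroup_le hP ht
  have hD0 : 0 ≤ D := (norm_nonneg _).trans (hD 0)
  have h1 : ‖Q (P y)‖ ≤ ‖Q * (P - 1)‖ * D := by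
    have hlim : Tendsto (fun N : ℕ => (N : ℝ)⁻¹ * D + ‖Q * (P - 1)‖ * D) atTop
        (𝓝 (‖Q * (P - 1)‖ * D)) := by
      simpa using ((tendsto_inv_atTop_nhds_zero_nat (𝕜 := ℝ)).mul_const D).add_const
        (‖Q * (P - 1)‖ * D)
    refine ge_of_tendsto hlim ((eventually_ne_atTop 0).mono fun N hN => ?_)
    have hN' : (N : ℝ) ≠ 0 := by exact_mod_cast hN
    set w := ∑ n ∈ Finset.Icc 1 N, (∑ j ∈ Finset.Icc 1 n, P ^ j) y
    have hw : ‖w‖ ≤ N * D := (norm_sum_le_of_le _ fun n _ => hD n).trans (by simp)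
    -- Here `v = -w/N`; the other term is `O(1/N)`.
    have e : P y = (N : ℝ)⁻¹ • (P ((∑ j ∈ Finset.Icc 1 N, P ^ j) y) - (P - 1) w) := by
      rw [sub_one_sum_sum_pow_apply, sub_sub_cancel, smul_smul, inv_mul_cancel₀ hN', one_smul]
    rw [e, map_smul, norm_smul, norm_inv, Real.norm_natCast, map_sub,
      ← mul_apply_eq_comp Q (P - 1)]
    have h2 : ‖Q (P ((∑ j ∈ Finset.Icc 1 N, P ^ j) y))‖ ≤ D := by
      have a := ContinuousLinearMap.le_of_opNorm_le _ hQ1 (P ((∑ j ∈ Finset.Icc 1 N, P ^ j) y))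
      have b := ContinuousLinearMap.le_of_opNorm_le _ hP ((∑ j ∈ Finset.Icc 1 N, P ^ j) y)
      linarith [hD N]
    have h3 : ‖(Q * (P - 1)) w‖ ≤ ‖Q * (P - 1)‖ * (N * D) :=
      ((Q * (P - 1)).le_opNorm w).trans (by gcongr)
    calc (N : ℝ)⁻¹ * _ ≤ (N : ℝ)⁻¹ * (D + ‖Q * (P - 1)‖ * (N * D)) := by
          gcongr
          exact (norm_sub_le _ _).trans (add_le_add h2 h3)
      _ = _ := by field_simp
  have e : Q y = Q (P y) - (Q * (P - 1)) y := by
    simp [map_sub]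
  rw [e, mul_add]
  exact (norm_sub_le _ _).trans (add_le_add h1 ((Q * (P - 1)).le_opNorm y))

end MeanErgodic

/-! ### The simple random walk on bounded sequences. -/

instance : Nontrivial (ℤ →ᵇ ℂ) :=
  ⟨0, 1, fun h => zero_ne_one (congrArg (fun f : ℤ →ᵇ ℂ => f 0) h)⟩

/-- Translation by `a` on bounded doubly infinite sequences. -/
noncomputable def translation (a : ℤ) : (ℤ →ᵇ ℂ) →L[ℝ] (ℤ →ᵇ ℂ) :=
  BoundedContinuousFunction.compContinuousCLM ℂ ℝ
    ⟨fun k : ℤ => k + a, continuous_of_discreteTopology⟩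

@[simp]
lemma translation_apply (a : ℤ) (f : ℤ →ᵇ ℂ) (k : ℤ) : translation a f k = f (k + a) := rfl

lemma norm_translation_le (a : ℤ) : ‖translation a‖ ≤ 1 := by
  refine ContinuousLinearMap.opNorm_le_bound _ zero_le_one fun f => ?_
  rw [one_mul, BoundedContinuousFunction.norm_le (norm_nonneg _)]
  exact fun k => f.norm_coe_le_norm _

lemma translation_mul (a b : ℤ) : translation a * translation b = translation (a + b) := by
  ext f k
  simp [add_assoc]

lemma translation_zero : translation 0 = 1 := by
  ext f k
  simp

lemma translation_pow (a : ℤ) (n : ℕ) : translation a ^ n = translation (n * a) := by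
  induction n with
  | zero => simp [translation_zero]
  | succ n ih => rw [pow_succ, ih, translation_mul]; push_cast; ring_nf

/-- The transition operator `(P f)_k = (f_{k-1} + f_{k+1}) / 2` of the simple random walk. -/
noncomputable def walkOperator : (ℤ →ᵇ ℂ) →L[ℝ] (ℤ →ᵇ ℂ) :=
  (1 / 2 : ℝ) • (translation 1 + translation (-1))

lemma walkOperator_apply (f : ℤ →ᵇ ℂ) (k : ℤ) :
    walkOperator f k = 1 / 2 * (f (k - 1) + f (k + 1)) := by
  rw [add_comm, sub_eq_add_neg]
  change (1 / 2 : ℝ) • (f (k + 1) + f (k + -1)) = _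
  rw [Complex.real_smul]
  norm_num

lemma norm_walkOperator_le : ‖walkOperator‖ ≤ 1 := by
  rw [walkOperator, norm_smul]
  have := (norm_add_le (translation 1) (translation (-1))).trans
    (add_le_add (norm_translation_le 1) (norm_translation_le (-1)))
  norm_num
  linarith

lemma norm_expSemigroup_walkOperator_mul_le {t : ℝ} (ht : 0 < t) :
    ‖expSemigroup walkOperator t * (walkOperator - 1)‖ ≤ t⁻¹ :=
  norm_expSemigroup_mul_sub_one_le (norm_translation_le 1) (norm_translation_le (-1))
    (by rw [translation_mul]; exact translation_zero)
    (by rw [translation_mul]; exact translation_zero) ht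

lemma tendsto_norm_expSemigroup_walkOperator_mul :
    Tendsto (fun t => ‖expSemigroup walkOperator t * (walkOperator - 1)‖) atTop (𝓝 0) :=
  squeeze_zero' (.of_forall fun _ => norm_nonneg _)
    ((eventually_gt_atTop 0).mono fun _ ht => norm_expSemigroup_walkOperator_mul_le ht)
    tendsto_inv_atTop_zero

lemma walkOperator_pow_apply (f : ℤ →ᵇ ℂ) (j : ℕ) (k : ℤ) :
    (walkOperator ^ j) f k = binomialAverage f j k := by
  have hc : Commute (translation 1) (translation (-1)) := by
    rw [Commute, SemiconjBy, translation_mul, translation_mul, add_comm]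
  rw [walkOperator, half_smul_add_pow hc]
  change (1 / 2 : ℝ) ^ j • ((∑ l ∈ Finset.range (j + 1),
    (j.choose l : ℝ) • (translation 1 ^ l * translation (-1) ^ (j - l))) f) k = _
  rw [sum_apply, BoundedContinuousFunction.coe_sum, Finset.sum_apply, binomialAverage,
    Complex.real_smul]
  congr 1
  · push_cast; rw [div_pow, one_pow]
  · refine Finset.sum_congr rfl fun l hl => ?_
    have hl' : l ≤ j := Nat.lt_succ_iff.1 (Finset.mem_range.1 hl)
    rw [translation_pow, translation_pow, translation_mul]
    change (j.choose l : ℝ) • f (k + ((l : ℤ) * 1 + ((j - l : ℕ) : ℤ) * -1)) = _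
    rw [Complex.real_smul, Complex.ofReal_natCast]
    congr 2
    push_cast [hl']
    ring

lemma powerMean_walkOperator_apply (f : ℤ →ᵇ ℂ) (n : ℕ) :
    ⇑(powerMean walkOperator n f) = cesaroMean f n := by
  ext k
  change (n : ℝ)⁻¹ • ((∑ j ∈ Finset.Icc 1 n, walkOperator ^ j) f) k = _
  rw [sum_apply, BoundedContinuousFunction.coe_sum, Finset.sum_apply, cesaroMean,
    Complex.real_smul]
  simp only [walkOperator_pow_apply]
  push_cast; rw [one_div]

/-! ### Supremum distance, fixed points and harmonic sequences. -/

lemma supDist_coe (f g : ℤ →ᵇ ℂ) : supDist f g = ENNReal.ofReal ‖f - g‖ := by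
  rw [ofReal_norm, BoundedContinuousFunction.enorm_eq_iSup_enorm]
  rfl

lemma tendsto_supDist_coe_iff {ι : Type*} {l : Filter ι} {u : ι → ℤ →ᵇ ℂ} {g : ℤ →ᵇ ℂ} :
    Tendsto (fun i => supDist (u i) g) l (𝓝 0) ↔ Tendsto (fun i => u i - g) l (𝓝 0) := by
  rw [tendsto_zero_iff_norm_tendsto_zero]
  simp only [supDist_coe]
  refine ⟨fun h => ?_, fun h => ?_⟩
  · simpa [Function.comp_def, ENNReal.toReal_ofReal] using
      (ENNReal.tendsto_toReal ENNReal.zero_ne_top).comp h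
  · simpa using ENNReal.tendsto_ofReal h

/-- The constant sequence `c`. -/
noncomputable def constSeq (c : ℂ) : ℤ →ᵇ ℂ := BoundedContinuousFunction.const ℤ c

lemma coe_constSeq (c : ℂ) : ⇑(constSeq c) = fun _ => c := rfl

lemma walkOperator_constSeq (c : ℂ) : walkOperator (constSeq c) = constSeq c := by
  ext k
  rw [walkOperator_apply, coe_constSeq]; ring

lemma pow_apply_of_apply_eq {E : Type*} [NormedAddCommGroup E] [NormedSpace ℝ E]
    {P : E →L[ℝ] E} {f : E} (hf : P f = f) (n : ℕ) : (P ^ n) f = f := by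
  induction n with
  | zero => rfl
  | succ n ih => rw [pow_succ, mul_apply_eq_comp, hf, ih]

lemma expSemigroup_apply_of_apply_eq {E : Type*} [NormedAddCommGroup E] [NormedSpace ℝ E]
    [CompleteSpace E] {P : E →L[ℝ] E} {f : E} (hf : P f = f) (t : ℝ) : expSemigroup P t f = f := by
  have h := hasSum_poissonWeight_smul_pow P t
  have h1 : HasSum (fun n => poissonWeight t n • f) (expSemigroup P t f) := by
    refine ((ContinuousLinearMap.apply ℝ E f).hasSum h).congr_fun fun n => ?_
    have := pow_apply_of_apply_eq hf n
    simp [this]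
  have h2 := (hasSum_poissonWeight t).smul_const f
  rw [one_smul] at h2
  exact h1.unique h2

lemma powerMean_apply_of_apply_eq {E : Type*} [NormedAddCommGroup E] [NormedSpace ℝ E]
    {P : E →L[ℝ] E} {f : E} (hf : P f = f) {n : ℕ} (hn : n ≠ 0) : powerMean P n f = f := by
  have hn' : (n : ℝ) ≠ 0 := by exact_mod_cast hn
  rw [powerMean, smul_apply, sum_apply,
    Finset.sum_congr rfl fun j _ => pow_apply_of_apply_eq hf j, Finset.sum_const,
    Nat.card_Icc, Nat.add_sub_cancel, ← Nat.cast_smul_eq_nsmul ℝ, smul_smul,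
    inv_mul_cancel₀ hn', one_smul]

/-- A bounded sequence that is harmonic for the simple random walk is constant. -/
lemma eq_constSeq_of_walkOperator_eq {f : ℤ →ᵇ ℂ} (hf : walkOperator f = f) :
    f = constSeq (f 0) := by
  -- Harmonic means equal consecutive differences, so `f` is affine; boundedness kills the slope.
  have hstep : ∀ k : ℤ, f (k + 1) - f k = f k - f (k - 1) := by
    intro k
    have := walkOperator_apply f k
    rw [hf] at this
    linear_combination -2 * this
  have hd : ∀ k : ℤ, f (k + 1) - f k = f 1 - f 0 := by
    intro k
    induction k using Int.induction_on with
    | zero => simp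
    | succ i ih => rw [hstep, add_sub_cancel_right, ih]
    | pred i ih => rw [hstep] at ih; simpa using ih
  have hlin : ∀ k : ℤ, f k = f 0 + k * (f 1 - f 0) := by
    intro k
    induction k using Int.induction_on with
    | zero => simp
    | succ i ih =>
      have := hd i
      push_cast at ih ⊢
      linear_combination this + ih
    | pred i ih =>
      have := hd (-i - 1)
      rw [sub_add_cancel] at this
      push_cast at ih ⊢
      linear_combination ih - this
  have hzero : f 1 - f 0 = 0 := by
    by_contra hne
    obtain ⟨n, hn⟩ := exists_nat_gt (2 * ‖f‖ / ‖f 1 - f 0‖)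
    rw [div_lt_iff₀ (norm_pos_iff.2 hne)] at hn
    have h1 : ‖f n - f 0‖ ≤ 2 * ‖f‖ :=
      (norm_sub_le _ _).trans (by linarith [f.norm_coe_le_norm n, f.norm_coe_le_norm 0])
    rw [hlin n, add_sub_cancel_left, norm_mul] at h1
    simp at h1
    linarith
  ext k
  rw [hlin k, hzero, coe_constSeq]; simp

/-! ### Existence and uniqueness of the solution. -/

lemma isSymmetricSolution_expSemigroup (f : ℤ →ᵇ ℂ) :
    IsSymmetricSolution f (fun t => expSemigroup walkOperator t f) where
  initial := by rw [expSemigroup_zero]; rfl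
  locally_bounded T := ⟨‖f‖, fun t ht k =>
    ((expSemigroup walkOperator t f).norm_coe_le_norm k).trans
      (norm_expSemigroup_apply_le norm_walkOperator_le ht.1 f)⟩
  ode k t ht := by
    have h1 : HasDerivAt (fun u => expSemigroup walkOperator u)
        ((walkOperator - 1) * expSemigroup walkOperator t) t :=
      hasDerivAt_exp_smul_const' (walkOperator - 1) t
    have h2 := ((BoundedContinuousFunction.evalCLM ℝ k).comp
      (ContinuousLinearMap.apply ℝ (ℤ →ᵇ ℂ) f)).hasFDerivAt.comp_hasDerivAt t h1
    rw [← walkOperator_apply]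
    exact h2.hasDerivWithinAt

/-- Picard iteration: the right-hand side is at most twice the supremum, and each integration from
zero data gains a factor `2t/(n+1)`. Letting `n → ∞` gives uniqueness. -/
lemma norm_le_of_locally_bounded_of_ode {d : ℝ → ℤ → ℂ} {T M : ℝ} (h0 : ∀ k, d 0 k = 0)
    (hM : ∀ t ∈ Set.Icc 0 T, ∀ k, ‖d t k‖ ≤ M)
    (hode : ∀ k t, 0 ≤ t → HasDerivWithinAt (fun s => d s k)
      ((1 / 2) * (d t (k - 1) + d t (k + 1)) - d t k) (Set.Ici 0) t) (n : ℕ) :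
    ∀ k, ∀ t ∈ Set.Icc 0 T, ‖d t k‖ ≤ M * ((2 * t) ^ n / n.factorial) := by
  induction n with
  | zero => intro k t ht; simpa using hM t ht k
  | succ n ih =>
    intro k
    refine image_norm_le_of_norm_deriv_right_le_deriv_boundary (f := fun t => d t k)
      (f' := fun t => (1 / 2) * (d t (k - 1) + d t (k + 1)) - d t k)
      (B' := fun t => 2 * (M * ((2 * t) ^ n / n.factorial)))
      (fun t ht => (hode k t ht.1).continuousWithinAt.mono Set.Icc_subset_Ici_self)
      (fun t ht => (hode k t ht.1).mono (Set.Ici_subset_Ici.2 ht.1)) (by simp [h0]) (fun t => ?_)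
      (fun t ht => ?_)
    · have h := ((((hasDerivAt_id t).const_mul 2).pow (n + 1)).div_const
        ((n + 1).factorial : ℝ)).const_mul M
      refine h.congr_deriv ?_
      have h1 : (n.factorial : ℝ) ≠ 0 := by exact_mod_cast n.factorial_ne_zero
      have h2 : (n : ℝ) + 1 ≠ 0 := by positivity
      rw [Nat.factorial_succ]
      push_cast
      simp only [id]
      field_simp
    · have ht' : t ∈ Set.Icc 0 T := Set.Ico_subset_Icc_self ht
      have a := ih (k - 1) t ht'
      have b := ih (k + 1) t ht'
      have c := ih k t ht'
      have e : ‖(1 / 2 : ℂ) * (d t (k - 1) + d t (k + 1))‖ ≤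
          1 / 2 * (‖d t (k - 1)‖ + ‖d t (k + 1)‖) := by
        rw [norm_mul]
        refine mul_le_mul (by norm_num) (norm_add_le _ _) (norm_nonneg _) (by norm_num)
      refine (norm_sub_le _ _).trans ?_
      linarith

lemma IsSymmetricSolution.eq {x₀ : ℤ → ℂ} {x y : ℝ → ℤ → ℂ} (hx : IsSymmetricSolution x₀ x)
    (hy : IsSymmetricSolution x₀ y) {t : ℝ} (ht : 0 ≤ t) : y t = x t := by
  obtain ⟨M, hM⟩ := hx.locally_bounded t
  obtain ⟨M', hM'⟩ := hy.locally_bounded t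
  have h := norm_le_of_locally_bounded_of_ode (d := fun t k => y t k - x t k) (T := t)
    (M := M' + M) (fun k => by simp [hx.initial, hy.initial])
    (fun s hs k => (norm_sub_le _ _).trans (add_le_add (hM' s hs k) (hM s hs k)))
    (fun k s hs => ((hy.ode k s hs).sub (hx.ode k s hs)).congr_deriv (by ring))
  ext k
  have hlim : Tendsto (fun n : ℕ => (M' + M) * ((2 * t) ^ n / n.factorial)) atTop (𝓝 0) := by
    simpa using (FloorSemiring.tendsto_pow_div_factorial_atTop (2 * t)).const_mul (M' + M)
  have := ge_of_tendsto' hlim fun n => h n k t ⟨ht, le_rfl⟩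
  exact sub_eq_zero.1 (norm_le_zero_iff.1 this)

lemma IsSymmetricSolution.eq_expSemigroup {f : ℤ →ᵇ ℂ} {x : ℝ → ℤ → ℂ}
    (hx : IsSymmetricSolution f x) {t : ℝ} (ht : 0 ≤ t) : x t = expSemigroup walkOperator t f :=
  (isSymmetricSolution_expSemigroup f).eq hx ht

lemma exists_boundedContinuousFunction_coe_eq {u : ℤ → ℂ} {C : ℝ} (hu : ∀ k, ‖u k‖ ≤ C) :
    ∃ f : ℤ →ᵇ ℂ, ⇑f = u :=
  ⟨BoundedContinuousFunction.ofNormedAddCommGroup u continuous_of_discreteTopology C hu, rfl⟩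

/-- A sequence at finite supremum distance from a bounded one is bounded. -/
lemma exists_coe_eq_of_supDist_ne_top {f : ℤ →ᵇ ℂ} {c : ℤ → ℂ} (h : supDist f c ≠ ∞) :
    ∃ g : ℤ →ᵇ ℂ, ⇑g = c := by
  refine exists_boundedContinuousFunction_coe_eq (C := ‖f‖ + (supDist f c).toReal) fun k => ?_
  have h1 : ‖f k - c k‖ₑ ≤ supDist f c := le_iSup (fun k => ‖f k - c k‖ₑ) k
  have h2 : ‖f k - c k‖ ≤ (supDist f c).toReal := by
    simpa using ENNReal.toReal_mono h h1
  have h3 : c k = f k - (f k - c k) := by ring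
  rw [h3]
  exact (norm_sub_le _ _).trans (add_le_add (f.norm_coe_le_norm k) h2)

/-! ### Translation back to constellations. -/

lemma tendsto_supDist_cesaroMean_iff (f : ℤ →ᵇ ℂ) (c : ℂ) :
    Tendsto (fun n : ℕ => supDist (cesaroMean f n) (fun _ => c)) atTop (𝓝 0) ↔
      Tendsto (fun n => powerMean walkOperator n (f - constSeq c)) atTop (𝓝 0) := by
  simp only [← powerMean_walkOperator_apply, ← coe_constSeq, tendsto_supDist_coe_iff]
  refine tendsto_congr' ((eventually_ne_atTop 0).mono fun n hn => ?_)
  simp only [map_sub, powerMean_apply_of_apply_eq (walkOperator_constSeq c) hn]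

lemma tendsto_supDist_solution_iff {f g : ℤ →ᵇ ℂ} (hg : walkOperator g = g) {x : ℝ → ℤ → ℂ}
    (hx : IsSymmetricSolution f x) :
    Tendsto (fun t => supDist (x t) g) atTop (𝓝 0) ↔
      Tendsto (fun t => expSemigroup walkOperator t (f - g)) atTop (𝓝 0) := by
  rw [tendsto_congr' ((eventually_ge_atTop 0).mono fun t ht =>
    show supDist (x t) g = supDist (expSemigroup walkOperator t f) g by
      rw [hx.eq_expSemigroup ht]), tendsto_supDist_coe_iff]
  simp only [map_sub, expSemigroup_apply_of_apply_eq hg]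

lemma tendsto_supDist_solution_const_iff (f : ℤ →ᵇ ℂ) (c : ℂ) {x : ℝ → ℤ → ℂ}
    (hx : IsSymmetricSolution f x) :
    Tendsto (fun t => supDist (x t) (fun _ => c)) atTop (𝓝 0) ↔
      Tendsto (fun n : ℕ => supDist (cesaroMean f n) (fun _ => c)) atTop (𝓝 0) := by
  rw [tendsto_supDist_cesaroMean_iff, ← coe_constSeq,
    tendsto_supDist_solution_iff (walkOperator_constSeq c) hx]
  exact ⟨tendsto_powerMean_of_tendsto_expSemigroup norm_walkOperator_le,
    tendsto_expSemigroup_of_tendsto_powerMean norm_walkOperator_le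
      tendsto_norm_expSemigroup_walkOperator_mul⟩

/-- The limit of a convergent solution is a constant sequence. -/
lemma exists_const_of_tendsto_supDist {f : ℤ →ᵇ ℂ} {x : ℝ → ℤ → ℂ}
    (hx : IsSymmetricSolution f x) {c : ℤ → ℂ}
    (h : Tendsto (fun t => supDist (x t) c) atTop (𝓝 0)) : ∃ a : ℂ, c = fun _ => a := by
  have h' : Tendsto (fun t => supDist (expSemigroup walkOperator t f) c) atTop (𝓝 0) :=
    h.congr' ((eventually_ge_atTop 0).mono fun t ht => by rw [hx.eq_expSemigroup ht])
  obtain ⟨t, ht⟩ := (h'.eventually_lt_const ENNReal.zero_lt_top).exists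
  -- A finite distance at a single time already puts the limit in `ℓ^∞(ℤ)`, where `P` acts.
  obtain ⟨g, rfl⟩ := exists_coe_eq_of_supDist_ne_top ht.ne
  have hg := apply_eq_of_tendsto_expSemigroup tendsto_norm_expSemigroup_walkOperator_mul
    (tendsto_sub_nhds_zero_iff.1 (tendsto_supDist_coe_iff.1 h'))
  exact ⟨g 0, congrArg DFunLike.coe (eq_constSeq_of_walkOperator_eq hg)⟩

lemma supDist_solution_le_of_supDist_cesaroMean_le (f : ℤ →ᵇ ℂ) (c : ℂ)
    (h : ∃ C : ℝ, 0 < C ∧ ∀ᶠ n : ℕ in atTop,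
      supDist (cesaroMean f n) (fun _ => c) ≤ ENNReal.ofReal (C * (n : ℝ)⁻¹))
    {x : ℝ → ℤ → ℂ} (hx : IsSymmetricSolution f x) :
    ∃ C : ℝ, 0 < C ∧ ∀ᶠ t : ℝ in atTop,
      supDist (x t) (fun _ => c) ≤ ENNReal.ofReal (C * t⁻¹) := by
  obtain ⟨C, hC, hb⟩ := h
  have hb' : ∀ᶠ n : ℕ in atTop,
      ‖powerMean walkOperator n (f - constSeq c)‖ ≤ C * (n : ℝ)⁻¹ := by
    filter_upwards [hb, eventually_ne_atTop 0] with n h1 hn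
    rw [← powerMean_walkOperator_apply, ← coe_constSeq, supDist_coe,
      ENNReal.ofReal_le_ofReal_iff (by positivity)] at h1
    rwa [map_sub, powerMean_apply_of_apply_eq (walkOperator_constSeq c) hn]
  obtain ⟨D, hD0, hD⟩ := exists_bound_sum_of_norm_powerMean_le norm_walkOperator_le hb'
  -- The `1` only makes the constant strictly positive.
  refine ⟨D + ‖f - constSeq c‖ + 1, by positivity, ?_⟩
  filter_upwards [eventually_gt_atTop 0] with t ht
  rw [hx.eq_expSemigroup ht.le, ← coe_constSeq, supDist_coe]
  refine ENNReal.ofReal_le_ofReal ?_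
  have h1 := norm_expSemigroup_apply_le_of_norm_sum_le norm_walkOperator_le ht.le hD
  rw [map_sub, expSemigroup_apply_of_apply_eq (walkOperator_constSeq c)] at h1
  calc _ ≤ _ := h1
    _ ≤ t⁻¹ * (D + ‖f - constSeq c‖ + 1) := by
        refine mul_le_mul (norm_expSemigroup_walkOperator_mul_le ht) (by linarith) (by positivity)
          (by positivity)
    _ = _ := mul_comm _ _

/-- The first conjunct says that "the solution" is meaningful; the others are: the
characterisation of good constellations, the identification of the limit, and the rate. -/
theorem theorem4p1 (x₀ : ℤ → ℂ) (hx₀ : Memℓp x₀ ∞) :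
    (∃ x : ℝ → ℤ → ℂ, IsSymmetricSolution x₀ x ∧
      ∀ y : ℝ → ℤ → ℂ, IsSymmetricSolution x₀ y → ∀ t : ℝ, 0 ≤ t → y t = x t) ∧
    (IsGood x₀ ↔
      ∃ c : ℂ, Tendsto (fun n : ℕ => supDist (cesaroMean x₀ n) (fun _ => c)) atTop (𝓝 0)) ∧
    (∀ c : ℂ, Tendsto (fun n : ℕ => supDist (cesaroMean x₀ n) (fun _ => c)) atTop (𝓝 0) →
      ∀ x : ℝ → ℤ → ℂ, IsSymmetricSolution x₀ x →
        Tendsto (fun t : ℝ => supDist (x t) (fun _ => c)) atTop (𝓝 0)) ∧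
    (∀ c : ℂ,
      (∃ C : ℝ, 0 < C ∧ ∀ᶠ n : ℕ in atTop,
        supDist (cesaroMean x₀ n) (fun _ => c) ≤ ENNReal.ofReal (C * (n : ℝ)⁻¹)) →
      ∀ x : ℝ → ℤ → ℂ, IsSymmetricSolution x₀ x →
        ∃ C : ℝ, 0 < C ∧ ∀ᶠ t : ℝ in atTop,
          supDist (x t) (fun _ => c) ≤ ENNReal.ofReal (C * t⁻¹)) := by
  obtain ⟨C, hC⟩ := hx₀.bddAbove
  obtain ⟨f, rfl⟩ := exists_boundedContinuousFunction_coe_eq (u := x₀) (C := C)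
    fun k => hC ⟨k, rfl⟩
  have hf := isSymmetricSolution_expSemigroup f
  refine ⟨⟨_, hf, fun y hy t ht => hf.eq hy ht⟩, ⟨?_, ?_⟩, fun c hc x hx =>
    (tendsto_supDist_solution_const_iff f c hx).2 hc, fun c h x hx =>
    supDist_solution_le_of_supDist_cesaroMean_le f c h hx⟩
  · rintro ⟨x, hx, c, hc⟩
    obtain ⟨a, rfl⟩ := exists_const_of_tendsto_supDist hx hc
    exact ⟨a, (tendsto_supDist_solution_const_iff f a hx).1 hc⟩
  · rintro ⟨c, hc⟩
    exact ⟨_, hf, _, (tendsto_supDist_solution_const_iff f c hf).2 hc⟩
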